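/- **Setting.** Let $N$ be a finite set of players. Each player $n$ has a nonempty finite linearly ordered type space $T_n$ and an action space $A_n\subset\mathbb R$ that is nonempty and either finite or a compact interval. Let $\tilde\Omega=\prod_{i=1}^{\bar k}\tilde\Omega_i$, where each $\tilde\Omega_i\subset\mathbb R$ is nonempty and either finite or a compact interval. All products carry the componentwise order, with $T_{-n}=\prod_{m\ne n}T_m$ and $A_{-n}=\prod_{m\neq n}A_m$. Let $\mathcal P(\tilde\Omega)$ be the set of Borel probability measures on $\tilde\Omega$ with the usual stochastic order: $\mu^1\le\mu^2$ iff $\int q\,d\mu^1\le\int q\,d\mu^2$ for every increasing $q:\tilde\Omega\to\mathbb R$ integrable under both. Write $\mu^1\vee\mu^2$ and $\mu^1\wedge\mu^2$ for the least upper and greatest lower bound in this order. A set $P\subseteq\mathcal P(\tilde\Omega)$ is a *sublattice* if $\mu^1\vee\mu^2$ and $\mu^1\wedge\mu^2$ exist and lie in $P$ for all $\mu^1,\mu^2\in P$. In the *induced set order*, $P^1\le P^2$ means that for all $\mu^1\in P^1$, $\mu^2\in P^2$, the measures $\mu^1\wedge\mu^2$ and $\mu^1\vee\mu^2$ exist,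 with $\mu^1\wedge\mu^2\in P^1$ and $\mu^1\vee\mu^2\in P^2$. A function $f(x,y)$ has *increasing differences* between $x$ and $y$ if $f(x^2,y^1)-f(x^1,y^1)\le f(x^2,y^2)-f(x^1,y^2)$ whenever $x^1\le x^2$, $y^1\le y^2$. **Game.** A special enterprising game $\Gamma$ consists, for all $n$, $t_n\in T_n$, $t_{-n}\in T_{-n}$, of continuous utilities $\tilde u_{n,t_n,t_{-n}}:A_n\times A_{-n}\times\tilde\Omega\to\mathbb R$, a probability vector $p_{n,t_n}=(p_{n,t_n|t_{-n}})_{t_{-n}}$ on $T_{-n}$, sets $\tilde P_{n,t_n,t_{-n}}\subseteq\mathcal P(\tilde\Omega)$ and $\mathcal K_{n,t_n}\subseteq\mathcal P(\tilde\Omega)^{T_{-n}}$ such that $\mathcal Q_{n,t_n}=\big(\prod_{t_{-n}}\tilde P_{n,t_n,t_{-n}}\big)\cap\mathcal K_{n,t_n}$ is nonempty. Against opponents' strategies $a_{-n}=(a_{m,t_m})_{m\ne n,\,t_m\in T_m}$, the satisfaction of player $n$ of type $t_n$ from the action $\alpha\in A_n$ is $$\tilde s_{n,t_n}(\alpha,a_{-n})=\sup_{\nu\in\mathcal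 Q_{n,t_n}}\sum_{t_{-n}\in T_{-n}}p_{n,t_n|t_{-n}}\int_{\tilde\Omega}\tilde u_{n,t_n,t_{-n}}\big(\alpha,(a_{m,t_m})_{m\neq n},\tilde\omega\big)\,\nu_{t_{-n}}(d\tilde\omega).$$ A *pure monotone equilibrium* is a profile $a=(a_n)_n$ of increasing maps $a_n:T_n\to A_n$ such that $a_{n,t_n}$ maximizes $\tilde s_{n,t_n}(\cdot,a_{-n})$ over $A_n$ for all $n$ and $t_n$. Profiles are ordered componentwise. **Monotonic assumptions.** (i) $\tilde u_{n,t_n,t_{-n}}(a_n,a_{-n},\tilde\omega)$ is increasing in $\tilde\omega$. (ii) For each $n$, it has increasing differences between $a_n$ and $(t_n,t_{-n},a_{-n},\tilde\omega)$, and between $(t_n,t_{-n},a_{-n})$ and $\tilde\omega$. (iii) $p_{n,t_n}$ is increasing in $t_n$ in the usual stochastic order. (iv) Each $\tilde P_{n,t_n,t_{-n}}$ is a sublattice. (v) $\tilde P_{n,t_n,t_{-n}}$ is increasing in $t_n$ in the induced set order. *Scenario A*: $p_{n,t_n}$ does not depend on $t_n$, and $\mathcal K_{n,t_n}$ is the set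 of all increasing maps $T_{-n}\to\mathcal P(\tilde\Omega)$. *Scenario B*: $\tilde P_{n,t_n,t_{-n}}$ does not depend on $t_{-n}$, and $\mathcal K_{n,t_n}$ is the set of all constant maps $T_{-n}\to\mathcal P(\tilde\Omega)$. **Theorem.** Let $\Lambda$ be a partially ordered set and $(\Gamma(\lambda))_{\lambda\in\Lambda}$ a family of such games with common $N$, $(T_n)$, $(A_n)$ and $\tilde\Omega$, each satisfying (i)–(v). Suppose that 1. for all $n,t_n,t_{-n},a_{-n}$, the function $\tilde u_{n,t_n,t_{-n}}(a_n,a_{-n},\tilde\omega|\lambda)$ has increasing differences between $(a_n,\tilde\omega)$ and $\lambda$; 2. either all $\Gamma(\lambda)$ are in scenario A and the $p_{n,t_n}(\lambda)$ do not depend on $\lambda$, or all $\Gamma(\lambda)$ are in scenario B and each $p_{n,t_n}(\lambda)$ is increasing in $\lambda$ in the usual stochastic order; 3. each $\tilde P_{n,t_n,t_{-n}}(\lambda)$ is increasing in $\lambda$ in the induced set order. Then every $\Gamma(\lambda)$ has a smallest pure monotone equilibrium $\tilde a_*(\lambda)$ and a largest one $\tilde a^*(\lambda)$, and both are increasing in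 $\lambda$. -/

import Mathlib

open MeasureTheory

noncomputable section

namespace EnterprisingGame

universe x y

/-- `f` has increasing differences between its two arguments. -/
def IncreasingDifferences {X : Type*} {Y : Type*} [Preorder X] [Preorder Y]
    (f : X → Y → ℝ) : Prop :=
  ∀ x₁ x₂ : X, x₁ ≤ x₂ → ∀ y₁ y₂ : Y, y₁ ≤ y₂ →
    f x₂ y₁ - f x₁ y₁ ≤ f x₂ y₂ - f x₁ y₂

/-- A nonempty set of reals that is finite or a compact interval. -/
def IsFiniteOrCompactInterval (s : Set ℝ) : Prop :=
  s.Nonempty ∧ (s.Finite ∨ ∃ a b : ℝ, s = Set.Icc a b)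

/-- The state space: a finite product of sets of reals, with the componentwise order,
the product topology and its Borel sigma-algebra. -/
abbrev State {k : ℕ} (S : Fin k → Set ℝ) : Type := ∀ i : Fin k, S i

/-- Families indexed by the opponents of player `n`. -/
abbrev Opp {N : Type x} (X : N → Type y) (n : N) : Type (max x y) :=
  ∀ m : {m : N // m ≠ n}, X m

section Stochastic

variable {Ω : Type*} [Preorder Ω] [MeasurableSpace Ω]

/-- The usual stochastic order on probability measures. -/
def StochLE (μ₁ μ₂ : ProbabilityMeasure Ω) : Prop :=
  ∀ q : Ω → ℝ, Monotone q → Measurable q →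
    Integrable q (μ₁ : Measure Ω) → Integrable q (μ₂ : Measure Ω) →
      ∫ ω, q ω ∂(μ₁ : Measure Ω) ≤ ∫ ω, q ω ∂(μ₂ : Measure Ω)

/-- `μ` is the join `μ₁ ∨ μ₂`, i.e. the least upper bound in the stochastic order. -/
def IsJoin (μ₁ μ₂ μ : ProbabilityMeasure Ω) : Prop :=
  StochLE μ₁ μ ∧ StochLE μ₂ μ ∧ ∀ ρ, StochLE μ₁ ρ → StochLE μ₂ ρ → StochLE μ ρ

/-- `μ` is the meet `μ₁ ∧ μ₂`, i.e. the greatest lower bound in the stochastic order. -/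
def IsMeet (μ₁ μ₂ μ : ProbabilityMeasure Ω) : Prop :=
  StochLE μ μ₁ ∧ StochLE μ μ₂ ∧ ∀ ρ, StochLE ρ μ₁ → StochLE ρ μ₂ → StochLE ρ μ

/-- The induced set order: `μ₁ ∧ μ₂ ∈ P₁` and `μ₁ ∨ μ₂ ∈ P₂` for `μ₁ ∈ P₁`, `μ₂ ∈ P₂`. -/
def InducedSetLE (P₁ P₂ : Set (ProbabilityMeasure Ω)) : Prop :=
  ∀ μ₁ ∈ P₁, ∀ μ₂ ∈ P₂, (∃ μ ∈ P₁, IsMeet μ₁ μ₂ μ) ∧ (∃ μ ∈ P₂, IsJoin μ₁ μ₂ μ)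

/-- A set of probability measures closed under meets and joins. -/
def IsSublatticeSet (P : Set (ProbabilityMeasure Ω)) : Prop :=
  ∀ μ₁ ∈ P, ∀ μ₂ ∈ P, (∃ μ ∈ P, IsMeet μ₁ μ₂ μ) ∧ (∃ μ ∈ P, IsJoin μ₁ μ₂ μ)

/-- The monotone maps from an ordered set to the stochastically ordered measures. -/
def monotoneMaps (X : Type*) [Preorder X] (Ω : Type*) [Preorder Ω] [MeasurableSpace Ω] :
    Set (X → ProbabilityMeasure Ω) :=
  {ν | ∀ t₁ t₂ : X, t₁ ≤ t₂ → StochLE (ν t₁) (ν t₂)}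

/-- The constant maps to the probability measures. -/
def constantMaps (X : Type*) (Ω : Type*) [MeasurableSpace Ω] :
    Set (X → ProbabilityMeasure Ω) :=
  {ν | ∃ μ, ∀ t, ν t = μ}

end Stochastic

/-- The `l`-weighted sum of every monotone `f` is at most the `l'`-weighted one. -/
def WeightLE {X : Type*} [Fintype X] [Preorder X] (l l' : X → ℝ) : Prop :=
  ∀ f : X → ℝ, Monotone f → ∑ t, l t * f t ≤ ∑ t, l' t * f t

variable {N : Type x} [Fintype N] [DecidableEq N]
  {T : N → Type y} [∀ n, Fintype (T n)] [∀ n, LinearOrder (T n)]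
  {A : N → Set ℝ} {k : ℕ} {S : Fin k → Set ℝ}

/-- A special enterprising game with players `N`, type spaces `T n`, action spaces `A n` and
state space `State S`. -/
structure SpecialGame (N : Type x) [Fintype N] [DecidableEq N]
    (T : N → Type y) [∀ n, Fintype (T n)] [∀ n, LinearOrder (T n)]
    (A : N → Set ℝ) {k : ℕ} (S : Fin k → Set ℝ) where
  /-- payoff-utility of own type, opponents' types, own action, opponents' actions, state -/
  u : ∀ n, T n → Opp T n → A n → Opp (fun m => A m) n → State S → ℝ
  /-- belief of a player of a given type on the opponents' types -/
  p : ∀ n, T n → Opp T n → ℝ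
  /-- componentwise prior sets -/
  P : ∀ n, T n → Opp T n → Set (ProbabilityMeasure (State S))
  /-- joint restriction on the prior vectors -/
  K : ∀ n, T n → Set (Opp T n → ProbabilityMeasure (State S))
  continuous_u : ∀ n tn t, Continuous
    (fun z : A n × Opp (fun m => A m) n × State S => u n tn t z.1 z.2.1 z.2.2)
  p_nonneg : ∀ n tn t, 0 ≤ p n tn t
  p_sum : ∀ n tn, ∑ t, p n tn t = 1
  exists_prior : ∀ n tn, ∃ ν ∈ K n tn, ∀ t, ν t ∈ P n tn t

namespace SpecialGame

variable (G : SpecialGame N T A S)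

/-- The set of prior vectors entertained by player `n` of type `tn`. -/
def Q (n : N) (tn : T n) : Set (Opp T n → ProbabilityMeasure (State S)) :=
  {ν | ∀ t, ν t ∈ G.P n tn t} ∩ G.K n tn

/-- Expected utility given all types, all actions and a state distribution. -/
def v (n : N) (tn : T n) (t : Opp T n) (an : A n) (b : Opp (fun m => A m) n)
    (μ : ProbabilityMeasure (State S)) : ℝ :=
  ∫ ω, G.u n tn t an b ω ∂(μ : Measure (State S))

/-- Expected utility given own type, own action, opponents' strategies and a prior vector. -/
def w (n : N) (tn : T n) (an : A n) (b : Opp (fun m => T m → A m) n)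
    (ν : Opp T n → ProbabilityMeasure (State S)) : ℝ :=
  ∑ t, G.p n tn t * G.v n tn t an (fun m => b m (t m)) (ν t)

/-- The satisfaction of the optimistic player: the supremum over the prior vectors. -/
def s (n : N) (tn : T n) (an : A n) (b : Opp (fun m => T m → A m) n) : ℝ :=
  sSup ((fun ν => G.w n tn an b ν) '' G.Q n tn)

/-- Best-response actions of player `n` of type `tn`. -/
def bestActions (n : N) (tn : T n) (b : Opp (fun m => T m → A m) n) : Set (A n) :=
  {an | ∀ an' : A n, G.s n tn an' b ≤ G.s n tn an b}

/-- Monotone best-response strategies of player `n` against monotone strategies. -/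
def bestStrategies (n : N) (b : Opp (fun m => T m →o A m) n) : Set (T n →o A n) :=
  {a | ∀ tn, a tn ∈ G.bestActions n tn (fun m => b m)}

/-- The joint best-response correspondence on profiles of monotone strategies. -/
def bestProfiles (a : ∀ n, T n →o A n) : Set (∀ n, T n →o A n) :=
  {a' | ∀ n, a' n ∈ G.bestStrategies n (fun m => a m)}

/-- The pure monotone equilibria, ordered componentwise. -/
def equilibria : Set (∀ n, T n →o A n) :=
  {a | a ∈ G.bestProfiles a}

/-- Higher states give higher utility; the utility has increasing differences between own
action and everything else, and between (types, opponents' actions) and the state; beliefs are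
stochastically monotone in own type; the prior sets are sublattices increasing in own type. -/
structure MonotonicAssumptions : Prop where
  mono_state : ∀ n tn t an b, Monotone (fun ω => G.u n tn t an b ω)
  incr_action : ∀ n, IncreasingDifferences
    (fun (an : A n) (e : T n × Opp T n × Opp (fun m => A m) n × State S) =>
      G.u n e.1 e.2.1 an e.2.2.1 e.2.2.2)
  incr_state : ∀ n (an : A n), IncreasingDifferences
    (fun (e : T n × Opp T n × Opp (fun m => A m) n) (ω : State S) =>
      G.u n e.1 e.2.1 an e.2.2 ω)
  mono_belief : ∀ n (t₁ t₂ : T n), t₁ ≤ t₂ → WeightLE (G.p n t₁) (G.p n t₂)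
  sublattice : ∀ n tn t, IsSublatticeSet (G.P n tn t)
  mono_prior : ∀ n (t : Opp T n) (t₁ t₂ : T n), t₁ ≤ t₂ →
    InducedSetLE (G.P n t₁ t) (G.P n t₂ t)

/-- Scenario A: beliefs do not depend on own type, and the prior vectors are the monotone
selections of the prior sets. -/
structure ScenarioA : Prop where
  belief : ∀ n (t₁ t₂ : T n), G.p n t₁ = G.p n t₂
  restriction : ∀ n tn, G.K n tn = monotoneMaps (Opp T n) (State S)

/-- Scenario B: the prior sets do not depend on the opponents' types, and the prior vectors
are constant. -/
structure ScenarioB : Prop where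
  prior : ∀ n tn (t t' : Opp T n), G.P n tn t = G.P n tn t'
  restriction : ∀ n tn, G.K n tn = constantMaps (Opp T n) (State S)

end SpecialGame

end EnterprisingGame

end

/-! The heart is a single inequality: the gain in satisfaction from replacing an action by a higher
one grows with own type, the opponents' monotone strategies and the parameter. For a fixed prior
vector this comes from increasing differences. The supremum over priors respects it because the
player is optimistic (`sSup_image_sub_le`): take a nearly optimal prior `a` for the high action in
the low problem and a nearly optimal `b` for the low action in the high problem. Their join is
feasible in the high problem; it raises the gain above that under `a`, and it is no worse than `b`
because utility increases in the state. Scenarios A and B are two ways to keep such joins feasible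
(`exists_mem_monotoneMaps_ge`, `exists_mem_constantMaps_ge`) and beliefs comparable
(`w_sub_le_w_sub`).

Satisfaction is continuous on a compact action set, so least and greatest best responses exist, and
by the inequality they increase in type, strategies and parameter. Knaster–Tarski on the complete
lattice of monotone profiles gives the extremal equilibria. These move with the parameter because an
equilibrium of one game is pre-fixed or post-fixed for the extremal best response of another. -/

open MeasureTheory Filter Topology

namespace EnterprisingGame

/-! ### Fixed points, completeness and monotone comparative statics -/

section Order

/-- Knaster–Tarski: in an order with all infima, a monotone map has a fixed point lying below all
its pre-fixed points. -/
theorem exists_fixedPoint_le_prefixed {α : Type*} [PartialOrder α]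
    (hα : ∀ s : Set α, ∃ x, IsGLB s x) {F : α → α} (hF : Monotone F) :
    ∃ x, F x = x ∧ ∀ y, F y ≤ y → x ≤ y := by
  obtain ⟨x, hx⟩ := hα {y | F y ≤ y}
  have h1 : F x ≤ x := hx.2 fun y hy => (hF (hx.1 hy)).trans hy
  exact ⟨x, le_antisymm h1 (hx.1 (hF h1)), fun y hy => hx.1 hy⟩

theorem exists_fixedPoint_ge_postfixed {α : Type*} [PartialOrder α]
    (hα : ∀ s : Set α, ∃ x, IsLUB s x) {F : α → α} (hF : Monotone F) :
    ∃ x, F x = x ∧ ∀ y, y ≤ F y → y ≤ x :=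
  exists_fixedPoint_le_prefixed (α := αᵒᵈ) hα hF.dual

/-- The lower bounds form a closed, hence compact, set containing the least element, so they have a
greatest member. -/
theorem exists_isGLB_of_compactSpace {α : Type*} [LinearOrder α] [TopologicalSpace α]
    [OrderClosedTopology α] [CompactSpace α] [Nonempty α] (s : Set α) : ∃ x, IsGLB s x := by
  obtain ⟨b, -, hb⟩ := isCompact_univ.exists_isLeast (Set.univ_nonempty (α := α))
  have hc : IsClosed (lowerBounds s) := by
    have : lowerBounds s = ⋂ x ∈ s, Set.Iic x := by
      ext; simp [lowerBounds]
    rw [this]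
    exact isClosed_biInter fun _ _ => isClosed_Iic
  exact hc.isCompact.exists_isGreatest ⟨b, fun x _ => hb (Set.mem_univ x)⟩

theorem exists_isLUB_of_compactSpace {α : Type*} [LinearOrder α] [TopologicalSpace α]
    [OrderClosedTopology α] [CompactSpace α] [Nonempty α] (s : Set α) : ∃ x, IsLUB s x :=
  haveI : CompactSpace αᵒᵈ := ‹CompactSpace α›
  exists_isGLB_of_compactSpace (α := αᵒᵈ) s

theorem exists_isGLB_orderHom_profile {N : Type*} {T B : N → Type*} [∀ n, Preorder (T n)]
    [∀ n, PartialOrder (B n)] (hB : ∀ n (s : Set (B n)), ∃ x, IsGLB s x)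
    (s : Set (∀ n, T n →o B n)) : ∃ x, IsGLB s x := by
  choose g hg using fun n (t : T n) => hB n ((fun a => a n t) '' s)
  refine ⟨fun n => ⟨g n, fun t t' h => (hg n t').2 ?_⟩, fun a ha n t => (hg n t).1 ⟨a, ha, rfl⟩,
    fun a ha n t => (hg n t).2 ?_⟩
  · rintro _ ⟨a, ha, rfl⟩
    exact ((hg n t).1 ⟨a, ha, rfl⟩).trans ((a n).monotone h)
  · rintro _ ⟨c, hc, rfl⟩
    exact ha hc n t

theorem exists_isLUB_orderHom_profile {N : Type*} {T B : N → Type*} [∀ n, Preorder (T n)]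
    [∀ n, PartialOrder (B n)] (hB : ∀ n (s : Set (B n)), ∃ x, IsLUB s x)
    (s : Set (∀ n, T n →o B n)) : ∃ x, IsLUB s x := by
  choose g hg using fun n (t : T n) => hB n ((fun a => a n t) '' s)
  refine ⟨fun n => ⟨g n, fun t t' h => (hg n t).2 ?_⟩, fun a ha n t => (hg n t).1 ⟨a, ha, rfl⟩,
    fun a ha n t => (hg n t).2 ?_⟩
  · rintro _ ⟨a, ha, rfl⟩
    exact ((a n).monotone h).trans ((hg n t').1 ⟨a, ha, rfl⟩)
  · rintro _ ⟨c, hc, rfl⟩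
    exact ha hc n t

/-- If an objective gains increasing differences, its maximizers increase in the strong set
order. -/
theorem maximizers_strongSetOrder {α : Type*} [LinearOrder α] {f g : α → ℝ}
    (hfg : ∀ x y, x ≤ y → f y - f x ≤ g y - g x) {x y : α}
    (hx : ∀ z, f z ≤ f x) (hy : ∀ z, g z ≤ g y) :
    (∀ z, f z ≤ f (min x y)) ∧ (∀ z, g z ≤ g (max x y)) := by
  rcases le_total x y with h | h
  · simpa [h] using ⟨hx, hy⟩
  · have h1 := hfg y x h
    have h2 := hx y
    have h3 := hy x
    simp only [h, min_eq_right, max_eq_left]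
    exact ⟨fun z => (hx z).trans (by linarith), fun z => (hy z).trans (by linarith)⟩

/-- Suprema over parameters inherit increasing differences when any two parameters taken from the
two sets are dominated within the second one. -/
theorem sSup_image_sub_le {α β : Type*} {r : β → β → Prop}
    {Q₁ Q₂ : Set β} (hne₁ : Q₁.Nonempty) (hne₂ : Q₂.Nonempty)
    (hdir : ∀ a ∈ Q₁, ∀ b ∈ Q₂, ∃ c ∈ Q₂, r a c ∧ r b c)
    {w₁ w₂ : α → β → ℝ}
    (hmono : ∀ x a b, r a b → w₂ x a ≤ w₂ x b)
    (hbdd₁ : ∀ x, BddAbove (w₁ x '' Q₁)) (hbdd₂ : ∀ x, BddAbove (w₂ x '' Q₂)) {x y : α}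
    (hdiff : ∀ a ∈ Q₁, ∀ b ∈ Q₂, r a b → w₁ y a - w₁ x a ≤ w₂ y b - w₂ x b) :
    sSup (w₁ y '' Q₁) - sSup (w₁ x '' Q₁) ≤ sSup (w₂ y '' Q₂) - sSup (w₂ x '' Q₂) := by
  refine le_of_forall_pos_le_add fun ε hε => ?_
  -- Only the two suprema that need an upper bound are approximated, each within `ε / 2`; the other
  -- two are bounded below by the values at `a` and `c`.
  obtain ⟨_, ⟨a, ha, rfl⟩, ha'⟩ := exists_lt_of_lt_csSup (hne₁.image (w₁ y))
    (sub_lt_self (sSup (w₁ y '' Q₁)) (half_pos hε))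
  obtain ⟨_, ⟨b, hb, rfl⟩, hb'⟩ := exists_lt_of_lt_csSup (hne₂.image (w₂ x))
    (sub_lt_self (sSup (w₂ x '' Q₂)) (half_pos hε))
  obtain ⟨c, hc, hac, hbc⟩ := hdir a ha b hb
  have h1 := hdiff a ha c hc hac
  have h2 := hmono x b c hbc
  have h3 := le_csSup (hbdd₁ x) ⟨a, ha, rfl⟩
  have h4 := le_csSup (hbdd₂ y) ⟨c, hc, rfl⟩
  linarith

end Order

/-! ### Stochastic order and joins of prior vectors -/

section Stochastic

variable {Ω : Type*} [Preorder Ω] [MeasurableSpace Ω]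

theorem _root_.Monotone.integrable_of_isBot_isTop {q : Ω → ℝ} (hq : Monotone q) (hm : Measurable q)
    {lo hi : Ω} (hlo : IsBot lo) (hhi : IsTop hi) (μ : Measure Ω) [IsFiniteMeasure μ] :
    Integrable q μ :=
  Integrable.of_mem_Icc (q lo) (q hi) hm.aemeasurable
    (ae_of_all _ fun ω => ⟨hq (hlo ω), hq (hhi ω)⟩)

/-- Extremal states bound every monotone test function, which makes it integrable under the middle
measure too. -/
theorem StochLE.trans {μ₁ μ₂ μ₃ : ProbabilityMeasure Ω} {lo hi : Ω} (hlo : IsBot lo)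
    (hhi : IsTop hi) (h₁ : StochLE μ₁ μ₂) (h₂ : StochLE μ₂ μ₃) : StochLE μ₁ μ₃ :=
  fun q hq hm i₁ i₃ =>
    have i₂ := hq.integrable_of_isBot_isTop hm hlo hhi (μ₂ : Measure Ω)
    (h₁ q hq hm i₁ i₂).trans (h₂ q hq hm i₂ i₃)

/-- Monotone selections of prior sets in the induced set order have monotone joins. -/
theorem exists_mem_monotoneMaps_ge {X : Type*} [Preorder X] {lo hi : Ω} (hlo : IsBot lo)
    (hhi : IsTop hi) {P₁ P₂ : X → Set (ProbabilityMeasure Ω)}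
    (hP : ∀ t, InducedSetLE (P₁ t) (P₂ t)) {ν₁ ν₂ : X → ProbabilityMeasure Ω}
    (h₁ : ν₁ ∈ {ν | ∀ t, ν t ∈ P₁ t} ∩ monotoneMaps X Ω)
    (h₂ : ν₂ ∈ {ν | ∀ t, ν t ∈ P₂ t} ∩ monotoneMaps X Ω) :
    ∃ ν ∈ {ν | ∀ t, ν t ∈ P₂ t} ∩ monotoneMaps X Ω,
      (∀ t, StochLE (ν₁ t) (ν t)) ∧ ∀ t, StochLE (ν₂ t) (ν t) := by
  choose ν hν hj using fun t => (hP t _ (h₁.1 t) _ (h₂.1 t)).2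
  -- The join at `t'` is an upper bound of both measures at `t`, hence lies above the join at `t`.
  exact ⟨ν, ⟨hν, fun t t' h => (hj t).2.2 _ ((h₁.2 t t' h).trans hlo hhi (hj t').1)
    ((h₂.2 t t' h).trans hlo hhi (hj t').2.1)⟩, fun t => (hj t).1, fun t => (hj t).2.1⟩

/-- Constant selections of prior sets in the induced set order have constant joins. -/
theorem exists_mem_constantMaps_ge {X : Type*}
    {P₁ P₂ : X → Set (ProbabilityMeasure Ω)} (hconst : ∀ t t', P₂ t = P₂ t')
    (hP : ∀ t, InducedSetLE (P₁ t) (P₂ t)) {ν₁ ν₂ : X → ProbabilityMeasure Ω}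
    (h₁ : ν₁ ∈ {ν | ∀ t, ν t ∈ P₁ t} ∩ constantMaps X Ω)
    (h₂ : ν₂ ∈ {ν | ∀ t, ν t ∈ P₂ t} ∩ constantMaps X Ω) :
    ∃ ν ∈ {ν | ∀ t, ν t ∈ P₂ t} ∩ constantMaps X Ω,
      (∀ t, StochLE (ν₁ t) (ν t)) ∧ ∀ t, StochLE (ν₂ t) (ν t) := by
  obtain ⟨hm₁, μ₁, e₁⟩ := h₁
  obtain ⟨hm₂, μ₂, e₂⟩ := h₂
  rcases isEmpty_or_nonempty X with _ | ⟨⟨t₀⟩⟩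
  · exact ⟨ν₂, ⟨hm₂, μ₂, e₂⟩, isEmptyElim, isEmptyElim⟩
  -- One join serves at every `t`, since `P₂` does not vary.
  obtain ⟨μ, hμ, hj⟩ := (hP t₀ _ (hm₁ t₀) _ (hm₂ t₀)).2
  refine ⟨fun _ => μ, ⟨fun t => hconst t₀ t ▸ hμ, μ, fun _ => rfl⟩, fun t => ?_, fun t => ?_⟩
  · rw [e₁ t, ← e₁ t₀]; exact hj.1
  · rw [e₂ t, ← e₂ t₀]; exact hj.2.1

end Stochastic

theorem IsFiniteOrCompactInterval.isCompact {s : Set ℝ} (hs : IsFiniteOrCompactInterval s) :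
    IsCompact s := by
  obtain ⟨-, h | ⟨a, b, rfl⟩⟩ := hs
  · exact h.isCompact
  · exact isCompact_Icc

theorem exists_isBot_state {k : ℕ} {S : Fin k → Set ℝ}
    (hS : ∀ i, IsFiniteOrCompactInterval (S i)) : ∃ lo : State S, IsBot lo := by
  choose f hf using fun i => (hS i).isCompact.exists_isLeast (hS i).1
  exact ⟨fun i => ⟨f i, (hf i).1⟩, fun ω i => (hf i).2 (ω i).2⟩

theorem exists_isTop_state {k : ℕ} {S : Fin k → Set ℝ}
    (hS : ∀ i, IsFiniteOrCompactInterval (S i)) : ∃ hi : State S, IsTop hi := by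
  choose f hf using fun i => (hS i).isCompact.exists_isGreatest (hS i).1
  exact ⟨fun i => ⟨f i, (hf i).1⟩, fun ω i => (hf i).2 (ω i).2⟩

namespace SpecialGame

variable {N : Type*} [Fintype N] [DecidableEq N]
  {T : N → Type*} [∀ n, Fintype (T n)] [∀ n, LinearOrder (T n)]
  {A : N → Set ℝ} {k : ℕ} {S : Fin k → Set ℝ}

/-! ### Continuity of satisfaction and extremal best responses -/

section Continuity

variable (G : SpecialGame N T A S) {n : N} (tn : T n)

theorem nonempty_Q : (G.Q n tn).Nonempty := by
  obtain ⟨ν, hK, hP⟩ := G.exists_prior n tn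
  exact ⟨ν, hP, hK⟩

theorem continuous_u_state (t : Opp T n) (an : A n) (b : Opp (fun m => A m) n) :
    Continuous (G.u n tn t an b) :=
  (G.continuous_u n tn t).comp (by fun_prop : Continuous fun ω : State S => (an, b, ω))

theorem sum_p_mul_add (f : Opp T n → ℝ) (ε : ℝ) :
    ∑ t, G.p n tn t * (f t + ε) = ∑ t, G.p n tn t * f t + ε := by
  simp [mul_add, Finset.sum_add_distrib, ← Finset.sum_mul, G.p_sum]

variable [CompactSpace (State S)]

theorem integrable_u (t : Opp T n) (an : A n) (b : Opp (fun m => A m) n)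
    (μ : ProbabilityMeasure (State S)) :
    Integrable (G.u n tn t an b) (μ : Measure (State S)) :=
  (BoundedContinuousFunction.mkOfCompact ⟨_, G.continuous_u_state tn t an b⟩).integrable _

theorem v_le_add_of_forall_u_le (t : Opp T n) {an an' : A n} {b : Opp (fun m => A m) n} {ε : ℝ}
    (h : ∀ ω, G.u n tn t an b ω ≤ G.u n tn t an' b ω + ε) (μ : ProbabilityMeasure (State S)) :
    G.v n tn t an b μ ≤ G.v n tn t an' b μ + ε := by
  have hi := G.integrable_u tn t an' b μ
  have := integral_mono (G.integrable_u tn t an b μ) (hi.add (integrable_const ε)) h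
  simpa [v, integral_add hi (integrable_const ε)] using this

theorem w_le_add_of_forall_u_le {an an' : A n} {b : Opp (fun m => T m → A m) n} {ε : ℝ}
    (h : ∀ t ω, G.u n tn t an (fun m => b m (t m)) ω ≤
      G.u n tn t an' (fun m => b m (t m)) ω + ε)
    (ν : Opp T n → ProbabilityMeasure (State S)) :
    G.w n tn an b ν ≤ G.w n tn an' b ν + ε := by
  unfold w
  rw [← G.sum_p_mul_add]
  exact Finset.sum_le_sum fun t _ => mul_le_mul_of_nonneg_left
    (G.v_le_add_of_forall_u_le tn t (h t) _) (G.p_nonneg n tn t)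

theorem bddAbove_w (an : A n) (b : Opp (fun m => T m → A m) n) :
    BddAbove (G.w n tn an b '' G.Q n tn) := by
  choose C hC using fun t : Opp T n =>
    (isCompact_range (G.continuous_u_state tn t an fun m => b m (t m))).bddAbove
  refine ⟨∑ t, G.p n tn t * C t, ?_⟩
  rintro _ ⟨ν, -, rfl⟩
  refine Finset.sum_le_sum fun t _ => mul_le_mul_of_nonneg_left ?_ (G.p_nonneg n tn t)
  simpa [v] using integral_mono (G.integrable_u tn t an _ (ν t)) (integrable_const (C t))
    fun ω => hC t ⟨ω, rfl⟩

theorem s_le_add_of_forall_u_le {an an' : A n} {b : Opp (fun m => T m → A m) n} {ε : ℝ}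
    (h : ∀ t ω, G.u n tn t an (fun m => b m (t m)) ω ≤
      G.u n tn t an' (fun m => b m (t m)) ω + ε) :
    G.s n tn an b ≤ G.s n tn an' b + ε := by
  refine csSup_le ((G.nonempty_Q tn).image _) ?_
  rintro _ ⟨ν, hν, rfl⟩
  refine (G.w_le_add_of_forall_u_le tn h ν).trans ?_
  have := le_csSup (G.bddAbove_w tn an' b) ⟨ν, hν, rfl⟩
  simpa [s] using this

/-- Compactness of the state space makes utility continuous in the action uniformly over states. A
uniform error in utility passes unchanged through expectations and suprema, whatever the priors. -/
theorem continuous_s (b : Opp (fun m => T m → A m) n) :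
    Continuous (fun an => G.s n tn an b) := by
  let c (t : Opp T n) : C(A n, C(State S, ℝ)) := ContinuousMap.curry
    ⟨fun z => G.u n tn t z.1 (fun m => b m (t m)) z.2, (G.continuous_u n tn t).comp
      (by fun_prop : Continuous fun z : A n × State S => (z.1, (fun m => b m (t m)), z.2))⟩
  refine continuous_iff_continuousAt.2 fun an => Metric.tendsto_nhds.2 fun ε hε => ?_
  have hc : ∀ᶠ an' in 𝓝 an, ∀ t, dist (c t an') (c t an) < ε / 2 := eventually_all.2 fun t =>
    Metric.tendsto_nhds.1 ((c t).continuous.tendsto an) _ (half_pos hε)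
  filter_upwards [hc] with an' h
  have hd (t ω) : |G.u n tn t an' (fun m => b m (t m)) ω -
      G.u n tn t an (fun m => b m (t m)) ω| < ε / 2 :=
    ((ContinuousMap.dist_apply_le_dist (f := c t an') (g := c t an) ω).trans_lt (h t))
  have h1 : G.s n tn an' b ≤ G.s n tn an b + ε / 2 :=
    G.s_le_add_of_forall_u_le tn fun t ω => by linarith [abs_lt.1 (hd t ω)]
  have h2 : G.s n tn an b ≤ G.s n tn an' b + ε / 2 :=
    G.s_le_add_of_forall_u_le tn fun t ω => by linarith [abs_lt.1 (hd t ω)]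
  rw [Real.dist_eq, abs_lt]
  constructor <;> linarith

variable [CompactSpace (A n)]

theorem isCompact_bestActions (b : Opp (fun m => T m → A m) n) :
    IsCompact (G.bestActions n tn b) := by
  have : G.bestActions n tn b = ⋂ an', {an | G.s n tn an' b ≤ G.s n tn an b} := by
    ext; simp [bestActions]
  rw [this]
  exact (isClosed_iInter fun an' =>
    isClosed_le continuous_const (G.continuous_s tn b)).isCompact

theorem nonempty_bestActions [Nonempty (A n)] (b : Opp (fun m => T m → A m) n) :
    (G.bestActions n tn b).Nonempty := by
  obtain ⟨an, -, h⟩ := isCompact_univ.exists_isMaxOn Set.univ_nonempty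
    (G.continuous_s tn b).continuousOn
  exact ⟨an, fun an' => h (Set.mem_univ an')⟩

theorem exists_isLeast_bestActions [Nonempty (A n)] (b : Opp (fun m => T m → A m) n) :
    ∃ an, IsLeast (G.bestActions n tn b) an :=
  (G.isCompact_bestActions tn b).exists_isLeast (G.nonempty_bestActions tn b)

theorem exists_isGreatest_bestActions [Nonempty (A n)] (b : Opp (fun m => T m → A m) n) :
    ∃ an, IsGreatest (G.bestActions n tn b) an :=
  (G.isCompact_bestActions tn b).exists_isGreatest (G.nonempty_bestActions tn b)

end Continuity

/-! ### Increasing differences of satisfaction -/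

section Comparison

variable [CompactSpace (State S)]

theorem MonotonicAssumptions.w_mono {G : SpecialGame N T A S} (hG : G.MonotonicAssumptions)
    {n : N} (tn : T n) (an : A n) (b : Opp (fun m => T m → A m) n)
    {ν₁ ν₂ : Opp T n → ProbabilityMeasure (State S)} (h : ∀ t, StochLE (ν₁ t) (ν₂ t)) :
    G.w n tn an b ν₁ ≤ G.w n tn an b ν₂ :=
  Finset.sum_le_sum fun t _ => mul_le_mul_of_nonneg_left
    (h t _ (hG.mono_state n tn t an _) (G.continuous_u_state tn t an _).measurable
      (G.integrable_u tn t an _ _) (G.integrable_u tn t an _ _)) (G.p_nonneg n tn t)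

theorem w_sub_w (G : SpecialGame N T A S) {n : N} (tn : T n) (an an' : A n)
    (b : Opp (fun m => T m → A m) n) (ν : Opp T n → ProbabilityMeasure (State S)) :
    G.w n tn an' b ν - G.w n tn an b ν = ∑ t, G.p n tn t *
      ∫ ω, (G.u n tn t an' (fun m => b m (t m)) ω - G.u n tn t an (fun m => b m (t m)) ω)
        ∂(ν t : Measure (State S)) := by
  simp only [w, v, ← Finset.sum_sub_distrib, ← mul_sub]
  refine Finset.sum_congr rfl fun t _ => ?_
  rw [integral_sub (G.integrable_u tn t an' _ _) (G.integrable_u tn t an _ _)]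

/-- The gain from a higher action grows with the utility gains, the beliefs and the priors. -/
theorem w_sub_le_w_sub {G₁ G₂ : SpecialGame N T A S} (hG₁ : G₁.MonotonicAssumptions) {n : N}
    {t₁ t₂ : T n} {b₁ b₂ : Opp (fun m => T m → A m) n} (hb₁ : ∀ m, Monotone (b₁ m))
    {x y : A n} (hxy : x ≤ y)
    (hu : ∀ t ω, G₁.u n t₁ t y (fun m => b₁ m (t m)) ω - G₁.u n t₁ t x (fun m => b₁ m (t m)) ω ≤
      G₂.u n t₂ t y (fun m => b₂ m (t m)) ω - G₂.u n t₂ t x (fun m => b₂ m (t m)) ω)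
    {ν₁ ν₂ : Opp T n → ProbabilityMeasure (State S)} (hν : ∀ t, StochLE (ν₁ t) (ν₂ t))
    (hp : G₁.p n t₁ = G₂.p n t₂ ∨
      WeightLE (G₁.p n t₁) (G₂.p n t₂) ∧ ν₁ ∈ constantMaps (Opp T n) (State S)) :
    G₁.w n t₁ y b₁ ν₁ - G₁.w n t₁ x b₁ ν₁ ≤ G₂.w n t₂ y b₂ ν₂ - G₂.w n t₂ x b₂ ν₂ := by
  rw [w_sub_w, w_sub_w]
  have hi₁ (t) (μ : ProbabilityMeasure (State S)) :=
    (G₁.integrable_u t₁ t y (fun m => b₁ m (t m)) μ).sub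
      (G₁.integrable_u t₁ t x (fun m => b₁ m (t m)) μ)
  have hi₂ (t) (μ : ProbabilityMeasure (State S)) :=
    (G₂.integrable_u t₂ t y (fun m => b₂ m (t m)) μ).sub
      (G₂.integrable_u t₂ t x (fun m => b₂ m (t m)) μ)
  have hmono {t t' : Opp T n} {ω ω' : State S} (ht : t ≤ t') (hω : ω ≤ ω') :=
    hG₁.incr_action n x y hxy (t₁, t, (fun m => b₁ m (t m)), ω)
      (t₁, t', (fun m => b₁ m (t' m)), ω') ⟨le_rfl, ht, fun m => hb₁ m (ht m), hω⟩
  -- Beliefs change first, then priors and utilities. With a constant prior the expected gain is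
  -- monotone in the opponents' types, so it is a valid test function for `WeightLE`.
  calc _ ≤ ∑ t, G₂.p n t₂ t * ∫ ω, (G₁.u n t₁ t y (fun m => b₁ m (t m)) ω -
          G₁.u n t₁ t x (fun m => b₁ m (t m)) ω) ∂(ν₁ t : Measure (State S)) := by
        rcases hp with hp | ⟨hp, μ, hμ⟩
        · rw [hp]
        · simp only [hμ]
          exact hp _ fun t t' h => integral_mono (hi₁ t μ) (hi₁ t' μ) fun ω => hmono h le_rfl
    _ ≤ _ := Finset.sum_le_sum fun t _ => mul_le_mul_of_nonneg_left
        -- The utility gain is itself increasing in the state, so it can be tested against the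
        -- stochastic order.
        ((hν t _ (fun ω ω' h => hmono le_rfl h)
          ((G₁.continuous_u_state t₁ t y _).sub (G₁.continuous_u_state t₁ t x _)).measurable
          (hi₁ t _) (hi₁ t _)).trans (integral_mono (hi₁ t _) (hi₂ t _) (hu t)))
        (G₂.p_nonneg n t₂ t)

/-- Two games in scenario A with a common belief, or two games in scenario B with ordered
beliefs. -/
def Comparable (G₁ G₂ : SpecialGame N T A S) (n : N) (t₁ t₂ : T n) : Prop :=
  (G₁.ScenarioA ∧ G₂.ScenarioA ∧ G₁.p n t₁ = G₂.p n t₂) ∨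
    (G₁.ScenarioB ∧ G₂.ScenarioB ∧ WeightLE (G₁.p n t₁) (G₂.p n t₂))

theorem s_sub_le_s_sub (hS : ∀ i, IsFiniteOrCompactInterval (S i))
    {G₁ G₂ : SpecialGame N T A S} (hG₁ : G₁.MonotonicAssumptions)
    (hG₂ : G₂.MonotonicAssumptions) {n : N} {t₁ t₂ : T n}
    (hc : Comparable G₁ G₂ n t₁ t₂)
    (hP : ∀ t, InducedSetLE (G₁.P n t₁ t) (G₂.P n t₂ t))
    {b₁ b₂ : Opp (fun m => T m → A m) n} (hb₁ : ∀ m, Monotone (b₁ m)) {x y : A n} (hxy : x ≤ y)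
    (hu : ∀ t ω, G₁.u n t₁ t y (fun m => b₁ m (t m)) ω - G₁.u n t₁ t x (fun m => b₁ m (t m)) ω ≤
      G₂.u n t₂ t y (fun m => b₂ m (t m)) ω - G₂.u n t₂ t x (fun m => b₂ m (t m)) ω) :
    G₁.s n t₁ y b₁ - G₁.s n t₁ x b₁ ≤ G₂.s n t₂ y b₂ - G₂.s n t₂ x b₂ := by
  obtain ⟨lo, hlo⟩ := exists_isBot_state hS
  obtain ⟨hi, hhi⟩ := exists_isTop_state hS
  refine sSup_image_sub_le (r := fun ν₁ ν₂ => ∀ t, StochLE (ν₁ t) (ν₂ t))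
    (w₁ := fun an => G₁.w n t₁ an b₁) (w₂ := fun an => G₂.w n t₂ an b₂)
    (G₁.nonempty_Q t₁) (G₂.nonempty_Q t₂) (fun ν₁ h₁ ν₂ h₂ => ?_)
    (fun an _ _ h => hG₂.w_mono t₂ an b₂ h) (fun an => G₁.bddAbove_w t₁ an b₁)
    (fun an => G₂.bddAbove_w t₂ an b₂)
    (fun ν₁ h₁ ν₂ h₂ h => w_sub_le_w_sub hG₁ hb₁ hxy hu h ?_)
  · unfold Q at h₁ h₂ ⊢
    rcases hc with ⟨hA₁, hA₂, -⟩ | ⟨hB₁, hB₂, -⟩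
    · rw [hA₁.restriction] at h₁
      rw [hA₂.restriction] at h₂ ⊢
      exact exists_mem_monotoneMaps_ge hlo hhi hP h₁ h₂
    · rw [hB₁.restriction] at h₁
      rw [hB₂.restriction] at h₂ ⊢
      exact exists_mem_constantMaps_ge (hB₂.prior n t₂) hP h₁ h₂
  · rcases hc with ⟨-, -, hp⟩ | ⟨hB, -, hp⟩
    · exact Or.inl hp
    · exact Or.inr ⟨hp, hB.restriction n t₁ ▸ h₁.2⟩

end Comparison

end SpecialGame

end EnterprisingGame

/-! ### Extremal equilibria and their comparative statics -/

theorem theorem8 {N : Type*} [Fintype N] [DecidableEq N]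
    {T : N → Type*} [∀ n, Fintype (T n)] [∀ n, LinearOrder (T n)] [∀ n, Nonempty (T n)]
    {A : N → Set ℝ} (hA : ∀ n, EnterprisingGame.IsFiniteOrCompactInterval (A n))
    {k : ℕ} {S : Fin k → Set ℝ} (hS : ∀ i, EnterprisingGame.IsFiniteOrCompactInterval (S i))
    {Λ : Type*} [PartialOrder Λ]
    (G : Λ → EnterprisingGame.SpecialGame N T A S)
    (hmono : ∀ l, (G l).MonotonicAssumptions)
    (hutility : ∀ n tn t (b : EnterprisingGame.Opp (fun m => A m) n),
      EnterprisingGame.IncreasingDifferences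
        (fun (e : A n × EnterprisingGame.State S) (l : Λ) => (G l).u n tn t e.1 b e.2))
    (hscenario :
      ((∀ l, (G l).ScenarioA) ∧ ∀ (l₁ l₂ : Λ) n tn, (G l₁).p n tn = (G l₂).p n tn) ∨
      ((∀ l, (G l).ScenarioB) ∧ ∀ (l₁ l₂ : Λ), l₁ ≤ l₂ → ∀ n tn,
        EnterprisingGame.WeightLE ((G l₁).p n tn) ((G l₂).p n tn)))
    (hprior : ∀ n tn t (l₁ l₂ : Λ), l₁ ≤ l₂ →
      EnterprisingGame.InducedSetLE ((G l₁).P n tn t) ((G l₂).P n tn t)) :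
    ∃ aMin aMax : Λ → ∀ n, T n →o A n,
      (∀ l, IsLeast (G l).equilibria (aMin l)) ∧
      (∀ l, IsGreatest (G l).equilibria (aMax l)) ∧
      Monotone aMin ∧ Monotone aMax := by
  have hAc (n) : CompactSpace (A n) := isCompact_iff_compactSpace.1 (hA n).isCompact
  have hAn (n) : Nonempty (A n) := (hA n).1.to_subtype
  have hSc (i) : CompactSpace (S i) := isCompact_iff_compactSpace.1 (hS i).isCompact
  have hs {l₁ l₂ : Λ} (hl : l₁ ≤ l₂) {n} {t₁ t₂ : T n} (ht : t₁ ≤ t₂)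
      {a₁ a₂ : ∀ n, T n →o A n} (ha : a₁ ≤ a₂) (x y : A n) (hxy : x ≤ y) :
      (G l₁).s n t₁ y (fun m => a₁ m) - (G l₁).s n t₁ x (fun m => a₁ m) ≤
        (G l₂).s n t₂ y (fun m => a₂ m) - (G l₂).s n t₂ x (fun m => a₂ m) := by
    -- Types and strategies move within one game, then the parameter moves alone: `hutility` and
    -- `hprior` compare games only at equal types, and `hutility` only at equal opponents' actions.
    trans (G l₁).s n t₂ y (fun m => a₂ m) - (G l₁).s n t₂ x (fun m => a₂ m)
    · exact EnterprisingGame.SpecialGame.s_sub_le_s_sub hS (hmono l₁) (hmono l₁)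
        (hscenario.imp (fun h => ⟨h.1 l₁, h.1 l₁, (h.1 l₁).belief n t₁ t₂⟩)
          fun h => ⟨h.1 l₁, h.1 l₁, (hmono l₁).mono_belief n t₁ t₂ ht⟩)
        (fun t => (hmono l₁).mono_prior n t t₁ t₂ ht) (fun m => (a₁ m).monotone) hxy
        fun t ω => (hmono l₁).incr_action n x y hxy (t₁, t, (fun m => a₁ m (t m)), ω)
          (t₂, t, (fun m => a₂ m (t m)), ω) ⟨ht, le_rfl, fun m => ha m (t m), le_rfl⟩
    · refine EnterprisingGame.SpecialGame.s_sub_le_s_sub hS (hmono l₁) (hmono l₂)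
        (hscenario.imp (fun h => ⟨h.1 l₁, h.1 l₂, h.2 l₁ l₂ n t₂⟩)
          fun h => ⟨h.1 l₁, h.1 l₂, h.2 l₁ l₂ hl n t₂⟩)
        (fun t => hprior n t₂ t l₁ l₂ hl) (fun m => (a₂ m).monotone) hxy fun t ω => ?_
      have := hutility n t₂ t (fun m => a₂ m (t m)) (x, ω) (y, ω) ⟨hxy, le_rfl⟩ l₁ l₂ hl
      dsimp only at this
      linarith
  choose lo hlo using fun l (a : ∀ n, T n →o A n) n (tn : T n) =>
    (G l).exists_isLeast_bestActions tn (fun m => a m)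
  choose hi hhi using fun l (a : ∀ n, T n →o A n) n (tn : T n) =>
    (G l).exists_isGreatest_bestActions tn (fun m => a m)
  -- The smaller of the two least maximizers still solves the low problem, so the least solution
  -- there lies below it.
  have hlo_mono {l₁ l₂} (hl : l₁ ≤ l₂) {a₁ a₂} (ha : a₁ ≤ a₂) {n} {t₁ t₂ : T n} (ht : t₁ ≤ t₂) :
      lo l₁ a₁ n t₁ ≤ lo l₂ a₂ n t₂ :=
    ((hlo l₁ a₁ n t₁).2 (EnterprisingGame.maximizers_strongSetOrder (hs hl ht ha)
      (hlo l₁ a₁ n t₁).1 (hlo l₂ a₂ n t₂).1).1).trans (min_le_right _ _)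
  have hhi_mono {l₁ l₂} (hl : l₁ ≤ l₂) {a₁ a₂} (ha : a₁ ≤ a₂) {n} {t₁ t₂ : T n} (ht : t₁ ≤ t₂) :
      hi l₁ a₁ n t₁ ≤ hi l₂ a₂ n t₂ :=
    (le_max_left _ _).trans ((hhi l₂ a₂ n t₂).2 (EnterprisingGame.maximizers_strongSetOrder
      (hs hl ht ha) (hhi l₁ a₁ n t₁).1 (hhi l₂ a₂ n t₂).1).2)
  let L (l : Λ) (a : ∀ n, T n →o A n) : ∀ n, T n →o A n :=
    fun n => ⟨lo l a n, fun _ _ ht => hlo_mono le_rfl le_rfl ht⟩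
  let H (l : Λ) (a : ∀ n, T n →o A n) : ∀ n, T n →o A n :=
    fun n => ⟨hi l a n, fun _ _ ht => hhi_mono le_rfl le_rfl ht⟩
  have hL {l₁ l₂} (hl : l₁ ≤ l₂) {a₁ a₂} (ha : a₁ ≤ a₂) : L l₁ a₁ ≤ L l₂ a₂ :=
    fun n tn => hlo_mono hl ha le_rfl
  have hH {l₁ l₂} (hl : l₁ ≤ l₂) {a₁ a₂} (ha : a₁ ≤ a₂) : H l₁ a₁ ≤ H l₂ a₂ :=
    fun n tn => hhi_mono hl ha le_rfl
  choose aMin hMin hMin_le using fun l => EnterprisingGame.exists_fixedPoint_le_prefixed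
    (EnterprisingGame.exists_isGLB_orderHom_profile
      fun n s => EnterprisingGame.exists_isGLB_of_compactSpace s)
    (F := L l) fun _ _ ha => hL le_rfl ha
  choose aMax hMax hMax_ge using fun l => EnterprisingGame.exists_fixedPoint_ge_postfixed
    (EnterprisingGame.exists_isLUB_orderHom_profile
      fun n s => EnterprisingGame.exists_isLUB_of_compactSpace s)
    (F := H l) fun _ _ ha => hH le_rfl ha
  refine ⟨aMin, aMax, fun l => ⟨fun n tn => ?_, fun a ha => ?_⟩,
    fun l => ⟨fun n tn => ?_, fun a ha => ?_⟩, fun l₁ l₂ hl => ?_, fun l₁ l₂ hl => ?_⟩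
  · have h : aMin l n tn = lo l (aMin l) n tn := DFunLike.congr_fun (congrFun (hMin l) n).symm tn
    rw [h]
    exact (hlo l (aMin l) n tn).1
  -- Every equilibrium lies above the least best response to itself, so it is pre-fixed for `L l`.
  · exact hMin_le l a fun n tn => (hlo l a n tn).2 (ha n tn)
  · have h : aMax l n tn = hi l (aMax l) n tn := DFunLike.congr_fun (congrFun (hMax l) n).symm tn
    rw [h]
    exact (hhi l (aMax l) n tn).1
  · exact hMax_ge l a fun n tn => (hhi l a n tn).2 (ha n tn)
  -- The fixed point of `L l₂` is pre-fixed for the smaller map `L l₁`.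
  · exact hMin_le l₁ _ ((hL hl le_rfl).trans (hMin l₂).le)
  · exact hMax_ge l₂ _ ((hMax l₁).ge.trans (hH hl le_rfl))
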